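/- Let $d\ge 1$ and let $f(x)=\sum_{(i,j)\in Q}\beta_{i,j}x_ix_j+\sum_{j\in L}\alpha_jx_j+c$ be a quadratic polynomial in $x_1,\dots,x_d$, where $L\subseteq\{1,\dots,d\}$, $Q$ is a set of pairs of distinct indices (each unordered pair listed at most once), all $\beta_{i,j}$ with $(i,j)\in Q$ and all $\alpha_j$ with $j\in L$ are nonzero reals, and $c\in\mathbb R$. Let $\delta>0$ and let $p_1,\dots,p_d\in(\delta,\tfrac12-\delta)\cup(\tfrac12+\delta,1-\delta)$. For a real scaling parameter $\gamma$ let $X_1,\dots,X_d$ be independent $\{+1,-1\}$-valued random variables with $\Pr(X_i=1)=p_i$ and mean $\mu_i=\mathbb E[X_i]$, and let $Y$ be a $\{0,1\}$-valued random variable with $\Pr(Y=1\mid X=x)=\sigma(\gamma f(x))$ for all $x\in\{+1,-1\}^d$, where $\sigma(t)=e^t/(1+e^t)$. Say that $Y$ depends on $X_1$ in the model if $x_1$ occurs in a term of $f$, i.e. $1\in L$ or $1$ belongs to some pair in $Q$. Let $G$ be the graph on $\{1,\dots,d\}$ whose edges are the pairs $\{i,j\}$ with $(i,j)\in Q$,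 and let $C$ be the connected component of $1$ in $G$. For a value $v$ that $f$ takes on $\{+1,-1\}^d$, say that $v$ fixes the signs of all parities if each $x_ix_j$, $(i,j)\in Q$, and each $x_j$, $j\in L$, is constant on $\{x\in\{+1,-1\}^d:|f(x)|=|v|\}$. Then $\mathbb E[Y(X_1-\mu_1)]=0$ whenever $Y$ is independent of $X_1$, and $Y$ is independent of $X_1$ for every $\gamma$ if $x_1$ occurs in no term of $f$. If $Y$ depends on $X_1$ in the model, then $\mathbb E[Y(X_1-\mu_1)]\neq0$ for all but finitely many $\gamma\in[0,1]$ under either of the following conditions. 1. $C\cap L\neq\emptyset$, and some nonzero value $v$ taken by $f$ on $\{+1,-1\}^d$ fixes the signs of all parities. 2. $C\cap L=\emptyset$, and every value $v$ taken by $f$ on $\{+1,-1\}^d$ (including $v=0$, if it is taken) fixes the signs of all parities. -/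

import Mathlib

open MeasureTheory ProbabilityTheory

/-- A quadratic polynomial `∑_{(i,j) ∈ Q} β i j * x i * x j + ∑_{j ∈ L} α j * x j + c` in `d`
variables, with nonzero coefficients on its index sets `Q` (quadratic terms) and `L` (linear terms).
Since `x i * x j = x j * x i`, each unordered pair is listed at most once in `Q`, and (by the
same field, with `i = j`) no pair is diagonal, as `x i ^ 2` is constant on `±1` inputs. -/
structure QuadPoly (d : ℕ) where
  Q : Finset (Fin d × Fin d)
  L : Finset (Fin d)
  β : Fin d → Fin d → ℝ
  α : Fin d → ℝ
  c : ℝ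
  asymm : ∀ i j, (i, j) ∈ Q → (j, i) ∉ Q
  β_ne_zero : ∀ i j, (i, j) ∈ Q → β i j ≠ 0
  α_ne_zero : ∀ j ∈ L, α j ≠ 0

/-- The Boolean cube `{+1, -1}^d`. -/
def signCube (d : ℕ) : Set (Fin d → ℝ) := {x | ∀ i, x i = 1 ∨ x i = -1}

namespace QuadPoly

variable {d : ℕ}

/-- The value of the polynomial at `x`. -/
noncomputable def eval (f : QuadPoly d) (x : Fin d → ℝ) : ℝ :=
  ∑ e ∈ f.Q, f.β e.1 e.2 * x e.1 * x e.2 + ∑ j ∈ f.L, f.α j * x j + f.c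

/-- The variables that the polynomial depends on: those that occur in a linear or quadratic term. -/
def weakSupport (f : QuadPoly d) : Set (Fin d) :=
  {i | i ∈ f.L ∨ ∃ j, (i, j) ∈ f.Q ∨ (j, i) ∈ f.Q}

/-- The graph of the quadratic terms. -/
def graph (f : QuadPoly d) : SimpleGraph (Fin d) where
  Adj i j := (i, j) ∈ f.Q ∨ (j, i) ∈ f.Q
  symm := ⟨fun _ _ h => h.symm⟩
  loopless := ⟨fun i h => by
    rcases h with h | h <;> exact f.asymm i i h h⟩

/-- The values that the polynomial takes on the Boolean cube. -/
def values (f : QuadPoly d) : Set ℝ := f.eval '' signCube d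

/-- On the Boolean cube, `|f| = |v|` fixes the signs of all parities `x i * x j`, `(i, j) ∈ Q`,
and `x j`, `j ∈ L`. -/
def FixesSigns (f : QuadPoly d) (v : ℝ) : Prop :=
  ∀ x ∈ signCube d, ∀ y ∈ signCube d, |f.eval x| = |v| → |f.eval y| = |v| →
    (∀ i j, (i, j) ∈ f.Q → x i * x j = y i * y j) ∧ (∀ j ∈ f.L, x j = y j)

end QuadPoly

/-- The logistic regression model: the inputs `X i` are independent, `±1`-valued, equal to `1`
with probability `p i`, and `Y` is a `0/1`-valued response with
`Pr(Y = 1 | X = x) = σ (γ * f x)`, where `σ t = exp t / (1 + exp t)`. -/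
structure IsLogisticModel {d : ℕ} {Ω : Type*} [MeasurableSpace Ω] (μ : Measure Ω)
    (f : QuadPoly d) (p : Fin d → ℝ) (γ : ℝ) (X : Fin d → Ω → ℝ) (Y : Ω → ℝ) : Prop where
  isProbabilityMeasure : IsProbabilityMeasure μ
  measurable_X : ∀ i, Measurable (X i)
  measurable_Y : Measurable Y
  X_mem : ∀ i, ∀ᵐ ω ∂μ, X i ω = 1 ∨ X i ω = -1
  Y_mem : ∀ᵐ ω ∂μ, Y ω = 0 ∨ Y ω = 1
  indep : iIndepFun X μ
  bias : ∀ i, μ.real {ω | X i ω = 1} = p i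
  cond_prob : ∀ x ∈ signCube d,
    (ProbabilityTheory.cond μ {ω | ∀ i, X i ω = x i}).real {ω | Y ω = 1}
      = Real.exp (γ * f.eval x) / (1 + Real.exp (γ * f.eval x))

/-- The correlation `E[Y (Z - E[Z])]`. -/
noncomputable def correlation {Ω : Type*} [MeasurableSpace Ω] (μ : Measure Ω) (Y Z : Ω → ℝ) : ℝ :=
  ∫ ω, Y ω * (Z ω - ∫ ω', Z ω' ∂μ) ∂μ

/-! Summing over the cube, the correlation is `cubeCorrelation`, a finite combination of the
functions `σ (γ * f x)`, hence real analytic in `γ`: infinitely many zeros in `[0, 1]` would make it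
vanish for all real `γ`. The functions `(1 + exp (t * v))⁻¹`, `v > 0`, are linearly independent, so
vanishing forces, for every `v ≠ 0`, the centred weights on `|f| = |v|`, signed by `f`, to sum to
zero (`sum_mul_sign_eq_zero_of_sum_sigmoid`). If `v` is taken and fixes the signs, this set is the
level set `f = v`.

Case 1: a linear variable in the component of `k` pins down `x k` on the level set, so all centred
weights have one strict sign, a contradiction.

Case 2: flipping the whole component of `k` preserves `f`, and every point of a level set agrees
there with a reference point `z` up to a common sign. Choosing the likelier signs in `z` off `k`
makes each sum over a flipped pair positive, since no bias is `1 / 2`. The level of `z` may be `0`,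
which is why that value must fix signs too. -/

/-! ### Linear independence of sigmoids and zeros of analytic functions. -/

open Filter Topology in
/-- The functions `t ↦ (1 + exp (t * v))⁻¹`, `v > 0`, are linearly independent. -/
theorem eq_zero_of_sum_inv_one_add_exp (s : Finset ℝ) (b : ℝ → ℝ) :
    (∀ v ∈ s, 0 < v) → (∀ t : ℝ, ∑ v ∈ s, b v * (1 + Real.exp (t * v))⁻¹ = 0) →
    ∀ v ∈ s, b v = 0 := by
  induction s using Finset.induction_on_min with
  | empty => simp
  | insert a s ha ih =>
    intro hpos h
    have has : a ∉ s := fun h' => lt_irrefl _ (ha a h')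
    have hapos : 0 < a := hpos a (Finset.mem_insert_self _ _)
    -- Rescaled by `exp (t * a)`, with `a` the smallest exponent, only the term of `a` survives as
    -- `t → ∞`.
    have key : ∀ v, a ≤ v → Tendsto (fun t : ℝ => Real.exp (t * a) * (1 + Real.exp (t * v))⁻¹)
        atTop (𝓝 (if v = a then 1 else 0)) := by
      intro v hv
      have e : ∀ t : ℝ, Real.exp (t * a) * (1 + Real.exp (t * v))⁻¹
          = (Real.exp (-(t * a)) + Real.exp (t * (v - a)))⁻¹ := by
        intro t
        have h1 : Real.exp (t * v) = Real.exp (t * a) * Real.exp (t * (v - a)) := by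
          rw [← Real.exp_add]; ring_nf
        have h2 : Real.exp (t * a) * Real.exp (-(t * a)) = 1 := by
          rw [← Real.exp_add]; simp
        have h3 : 1 + Real.exp (t * v)
            = Real.exp (t * a) * (Real.exp (-(t * a)) + Real.exp (t * (v - a))) := by
          rw [mul_add, h2, h1]
        rw [h3, mul_inv, ← mul_assoc, mul_inv_cancel₀ (Real.exp_pos _).ne', one_mul]
      simp only [e]
      have l1 : Tendsto (fun t : ℝ => Real.exp (-(t * a))) atTop (𝓝 0) :=
        Real.tendsto_exp_neg_atTop_nhds_zero.comp (tendsto_id.atTop_mul_const hapos)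
      rcases hv.eq_or_lt with rfl | hlt
      · simpa using (l1.add_const 1).inv₀ (by norm_num)
      · rw [if_neg hlt.ne']
        refine Tendsto.inv_tendsto_atTop ?_
        exact l1.add_atTop (Real.tendsto_exp_atTop.comp
          (tendsto_id.atTop_mul_const (sub_pos.2 hlt)))
    have hle : ∀ v ∈ insert a s, a ≤ v := by
      intro v hv
      rcases Finset.mem_insert.1 hv with rfl | hv
      · exact le_rfl
      · exact (ha v hv).le
    have hlim := tendsto_finsetSum (insert a s) fun v hv => (key v (hle v hv)).const_mul (b v)
    have hz : ∀ t : ℝ, ∑ v ∈ insert a s, b v * (Real.exp (t * a) * (1 + Real.exp (t * v))⁻¹)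
        = 0 := by
      intro t
      rw [← mul_zero (Real.exp (t * a)), ← h t, Finset.mul_sum]
      exact Finset.sum_congr rfl fun v _ => by ring
    simp only [hz] at hlim
    have hba : b a = 0 := by
      have := tendsto_nhds_unique tendsto_const_nhds hlim
      simpa using this.symm
    intro v hv
    rcases Finset.mem_insert.1 hv with rfl | hv
    · exact hba
    · refine ih (fun v hv => hpos v (Finset.mem_insert_of_mem hv)) (fun t => ?_) v hv
      have := h t
      rwa [Finset.sum_insert has, hba, zero_mul, zero_add] at this

/-- Moves opposite values of `y` onto the same function of `t`, at the cost of a sign and a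
constant. It covers `y = 0` because `Real.sign 0 = 0`. -/
theorem sigmoid_mul_eq_sign (t y : ℝ) :
    Real.sigmoid (t * y) = (1 + Real.sign y) / 2 - Real.sign y * (1 + Real.exp (t * |y|))⁻¹ := by
  rcases lt_trichotomy y 0 with h | rfl | h
  · rw [Real.sign_of_neg h, abs_of_neg h, Real.sigmoid_def]
    simp
  · simp [Real.sigmoid_zero]
  · rw [Real.sign_of_pos h, abs_of_pos h, ← neg_neg (t * y), Real.sigmoid_neg, Real.sigmoid_def]
    simp

open Filter Topology in
/-- If a linear combination of the functions `t ↦ σ (t * g x)` vanishes, then for each `v ≠ 0` the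
coefficients with `|g x| = |v|`, signed by `g x`, sum to zero. -/
theorem sum_mul_sign_eq_zero_of_sum_sigmoid {ι : Type*} (s : Finset ι) (a g : ι → ℝ)
    (h : ∀ t : ℝ, ∑ x ∈ s, a x * Real.sigmoid (t * g x) = 0) {v : ℝ} (hv : v ≠ 0) :
    ∑ x ∈ s with |g x| = |v|, a x * Real.sign (g x) = 0 := by
  classical
  set K := ∑ x ∈ s, a x * ((1 + Real.sign (g x)) / 2)
  set s' := s.filter fun x => g x ≠ 0 with hs'
  set V := s'.image fun x => |g x| with hV
  set b : ℝ → ℝ := fun w => ∑ x ∈ s' with |g x| = w, a x * Real.sign (g x) with hb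
  have hVpos : ∀ w ∈ V, 0 < w := by
    intro w hw
    obtain ⟨x, hx, rfl⟩ := Finset.mem_image.1 hw
    exact abs_pos.2 (Finset.mem_filter.1 hx).2
  have hK : ∀ t : ℝ, ∑ w ∈ V, b w * (1 + Real.exp (t * w))⁻¹ = K := by
    intro t
    have h1 : ∑ w ∈ V, b w * (1 + Real.exp (t * w))⁻¹
        = ∑ x ∈ s', a x * Real.sign (g x) * (1 + Real.exp (t * |g x|))⁻¹ := by
      rw [← Finset.sum_fiberwise_of_maps_to
        (fun x hx => Finset.mem_image_of_mem (fun x => |g x|) hx)]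
      refine Finset.sum_congr rfl fun w _ => ?_
      rw [hb, Finset.sum_mul]
      refine Finset.sum_congr rfl fun x hx => ?_
      rw [(Finset.mem_filter.1 hx).2]
    have h2 : ∑ x ∈ s', a x * Real.sign (g x) * (1 + Real.exp (t * |g x|))⁻¹
        = ∑ x ∈ s, a x * Real.sign (g x) * (1 + Real.exp (t * |g x|))⁻¹ := by
      refine Finset.sum_filter_of_ne fun x _ hx h0 => hx ?_
      simp [h0]
    have h3 := h t
    simp only [sigmoid_mul_eq_sign, mul_sub, Finset.sum_sub_distrib, ← mul_assoc] at h3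
    rw [h1, h2]
    exact (sub_eq_zero.1 (by simpa only [K, ← mul_assoc] using h3)).symm
  -- All exponents in `V` are positive, so the left side of `hK` tends to `0` while the right side
  -- is constant.
  have hK0 : K = 0 := by
    have hl : Tendsto (fun t : ℝ => ∑ w ∈ V, b w * (1 + Real.exp (t * w))⁻¹) atTop
        (𝓝 (∑ w ∈ V, b w * 0)) := by
      refine tendsto_finsetSum _ fun w hw => Tendsto.const_mul _ ?_
      exact Tendsto.inv_tendsto_atTop (tendsto_const_nhds.add_atTop
        (Real.tendsto_exp_atTop.comp (tendsto_id.atTop_mul_const (hVpos w hw))))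
    simp only [hK, mul_zero, Finset.sum_const_zero] at hl
    exact tendsto_nhds_unique tendsto_const_nhds hl
  have hfin : ∑ x ∈ s with |g x| = |v|, a x * Real.sign (g x) = b |v| := by
    simp only [hb, hs', Finset.filter_filter]
    refine Finset.sum_congr (Finset.filter_congr fun x _ => ?_) fun _ _ => rfl
    refine ⟨fun h => ⟨fun h0 => hv ?_, h⟩, fun h => h.2⟩
    rw [h0, abs_zero] at h
    exact abs_eq_zero.1 h.symm
  rw [hfin]
  by_cases hmem : |v| ∈ V
  · exact eq_zero_of_sum_inv_one_add_exp V b hVpos (fun t => (hK t).trans hK0) _ hmem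
  · refine Finset.sum_eq_zero fun x hx => absurd ?_ hmem
    obtain ⟨hx, hxv⟩ := Finset.mem_filter.1 hx
    exact hxv ▸ Finset.mem_image_of_mem (fun x => |g x|) hx

/-- A real analytic function that vanishes at infinitely many points of a compact set is zero. -/
theorem AnalyticOnNhd.eq_zero_of_infinite_zeros {g : ℝ → ℝ} (hg : AnalyticOnNhd ℝ g Set.univ)
    {K : Set ℝ} (hK : IsCompact K) (h : {t ∈ K | g t = 0}.Infinite) (t : ℝ) : g t = 0 := by
  obtain ⟨z, -, hz⟩ := h.exists_accPt_of_subset_isCompact hK (Set.sep_subset _ _)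
  have hf := accPt_iff_frequently_nhdsNE.1 hz
  exact hg.eqOn_zero_of_preconnected_of_frequently_eq_zero isPreconnected_univ (Set.mem_univ z)
    (hf.mono fun t ht => ht.2) (Set.mem_univ t)

/-! ### Product weights on the cube and sign flips. -/

/-- The Boolean cube `{+1, -1}^d` as a finite set. -/
noncomputable def signFinset (d : ℕ) : Finset (Fin d → ℝ) :=
  Fintype.piFinset fun _ => {1, -1}

theorem mem_signFinset {d : ℕ} {x : Fin d → ℝ} : x ∈ signFinset d ↔ x ∈ signCube d := by
  simp [signFinset, signCube]

/-- The probability that a sign equal to `1` with probability `q` takes the value `s = ±1`. -/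
noncomputable def signProb (q s : ℝ) : ℝ := 1 / 2 + s * (q - 1 / 2)

theorem signProb_one (q : ℝ) : signProb q 1 = q := by simp [signProb]

theorem signProb_neg_one (q : ℝ) : signProb q (-1) = 1 - q := by
  simp only [signProb]; ring

theorem signProb_pos {q s : ℝ} (h0 : 0 < q) (h1 : q < 1) (hs : s = 1 ∨ s = -1) :
    0 < signProb q s := by
  rcases hs with rfl | rfl
  · rwa [signProb_one]
  · rw [signProb_neg_one]; linarith

/-- The sign that is more likely under the bias `q`. -/
noncomputable def likelySign (q : ℝ) : ℝ := if 1 / 2 < q then 1 else -1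

theorem signProb_neg_likelySign_lt {q : ℝ} (hq : q ≠ 1 / 2) :
    signProb q (-likelySign q) < signProb q (likelySign q) := by
  unfold likelySign
  split_ifs with h
  · rw [signProb_one, signProb_neg_one]; linarith
  · rw [neg_neg, signProb_one, signProb_neg_one]
    have := lt_of_le_of_ne (not_lt.1 h) hq
    linarith

/-- The probability of the point `x` of the cube for independent signs with biases `p`. -/
noncomputable def signWeight {d : ℕ} (p x : Fin d → ℝ) : ℝ := ∏ i, signProb (p i) (x i)

theorem signWeight_pos {d : ℕ} {p x : Fin d → ℝ} (hp : ∀ i, 0 < p i ∧ p i < 1)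
    (hx : x ∈ signCube d) : 0 < signWeight p x :=
  Finset.prod_pos fun i _ => signProb_pos (hp i).1 (hp i).2 (hx i)

/-- The product of the weight of `x` and its centred `k`-th coordinate. -/
noncomputable def centredWeight {d : ℕ} (p : Fin d → ℝ) (k : Fin d) (x : Fin d → ℝ) : ℝ :=
  signWeight p x * (x k - (2 * p k - 1))

/-- Flipping the signs of the coordinates in `A`. -/
def flipSigns {d : ℕ} (A : Finset (Fin d)) (x : Fin d → ℝ) : Fin d → ℝ :=
  fun i => if i ∈ A then -x i else x i

section flip

variable {d : ℕ} (A : Finset (Fin d))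

theorem flipSigns_of_mem {A : Finset (Fin d)} {i : Fin d} (h : i ∈ A) (x : Fin d → ℝ) :
    flipSigns A x i = -x i := if_pos h

theorem flipSigns_of_notMem {A : Finset (Fin d)} {i : Fin d} (h : i ∉ A) (x : Fin d → ℝ) :
    flipSigns A x i = x i := if_neg h

theorem flipSigns_flipSigns (x : Fin d → ℝ) : flipSigns A (flipSigns A x) = x := by
  ext i
  by_cases h : i ∈ A <;> simp [flipSigns, h]

theorem flipSigns_mem_signCube {x : Fin d → ℝ} (hx : x ∈ signCube d) :
    flipSigns A x ∈ signCube d := by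
  intro i
  by_cases h : i ∈ A
  · rw [flipSigns_of_mem h]
    rcases hx i with h | h <;> simp [h]
  · rw [flipSigns_of_notMem h]
    exact hx i

theorem QuadPoly.eval_congr (f : QuadPoly d) {x y : Fin d → ℝ}
    (hQ : ∀ i j, (i, j) ∈ f.Q → x i * x j = y i * y j) (hL : ∀ j ∈ f.L, x j = y j) :
    f.eval x = f.eval y := by
  simp only [QuadPoly.eval]
  congr 2
  · refine Finset.sum_congr rfl fun e he => ?_
    rw [mul_assoc, mul_assoc, hQ e.1 e.2 he]
  · exact Finset.sum_congr rfl fun j hj => by rw [hL j hj]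

/-- No quadratic term crosses the boundary of `A`, so every monomial has an even number of flipped
factors. -/
theorem QuadPoly.eval_flipSigns (f : QuadPoly d) {A : Finset (Fin d)}
    (hQ : ∀ i j, (i, j) ∈ f.Q → (i ∈ A ↔ j ∈ A)) (hL : ∀ j ∈ f.L, j ∉ A) (x : Fin d → ℝ) :
    f.eval (flipSigns A x) = f.eval x := by
  refine f.eval_congr (fun i j h => ?_) fun j hj => flipSigns_of_notMem (hL j hj) x
  by_cases hi : i ∈ A
  · rw [flipSigns_of_mem hi, flipSigns_of_mem ((hQ i j h).1 hi), neg_mul_neg]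
  · rw [flipSigns_of_notMem hi, flipSigns_of_notMem (fun h' => hi ((hQ i j h).2 h'))]

theorem signWeight_eq_mul_prod_erase {k : Fin d} (hk : k ∈ A) (p x : Fin d → ℝ) :
    signWeight p x = signProb (p k) (x k) * (∏ i ∈ A.erase k, signProb (p i) (x i)) *
      ∏ i ∈ Aᶜ, signProb (p i) (x i) := by
  rw [Finset.mul_prod_erase A (fun i => signProb (p i) (x i)) hk, Finset.prod_mul_prod_compl]
  rfl

/-- The factor of `k` is `p k * 2 * (1 - p k)` at `x k = 1` and the negative of this at `x k = -1`.
Hence the pair differs only in the remaining coordinates of `A`; for `A = {k}` it cancels. -/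
theorem centredWeight_add_flipSigns {k : Fin d} (hk : k ∈ A) (p : Fin d → ℝ) {x : Fin d → ℝ}
    (hx : x k = 1 ∨ x k = -1) :
    centredWeight p k x + centredWeight p k (flipSigns A x) =
      (∏ i ∈ Aᶜ, signProb (p i) (x i)) * (2 * p k * (1 - p k)) *
        (x k * (∏ i ∈ A.erase k, signProb (p i) (x i)
          - ∏ i ∈ A.erase k, signProb (p i) (-x i))) := by
  have h1 : ∏ i ∈ A.erase k, signProb (p i) (flipSigns A x i)
      = ∏ i ∈ A.erase k, signProb (p i) (-x i) :=
    Finset.prod_congr rfl fun i hi => by rw [flipSigns_of_mem (Finset.mem_of_mem_erase hi)]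
  have h2 : ∏ i ∈ Aᶜ, signProb (p i) (flipSigns A x i) = ∏ i ∈ Aᶜ, signProb (p i) (x i) :=
    Finset.prod_congr rfl fun i hi => by rw [flipSigns_of_notMem (Finset.mem_compl.1 hi)]
  rw [centredWeight, centredWeight, signWeight_eq_mul_prod_erase A hk p x,
    signWeight_eq_mul_prod_erase A hk p (flipSigns A x), h1, h2, flipSigns_of_mem hk]
  rcases hx with h | h <;> rw [h] <;> simp only [neg_neg, signProb_one, signProb_neg_one] <;> ring

theorem two_mul_sum_eq_sum_add_flipSigns (S : Finset (Fin d → ℝ))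
    (hS : ∀ x ∈ S, flipSigns A x ∈ S) (g : (Fin d → ℝ) → ℝ) :
    2 * ∑ x ∈ S, g x = ∑ x ∈ S, (g x + g (flipSigns A x)) := by
  rw [Finset.sum_add_distrib, two_mul]
  congr 1
  exact Finset.sum_nbij' (flipSigns A) (flipSigns A) hS hS
    (fun x _ => flipSigns_flipSigns A x) (fun x _ => flipSigns_flipSigns A x)
    fun x _ => by rw [flipSigns_flipSigns]

end flip

theorem sum_centredWeight {d : ℕ} (p : Fin d → ℝ) (k : Fin d) :
    ∑ x ∈ signFinset d, centredWeight p k x = 0 := by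
  have h := two_mul_sum_eq_sum_add_flipSigns {k} (signFinset d)
    (fun x hx => mem_signFinset.2 (flipSigns_mem_signCube _ (mem_signFinset.1 hx)))
    (centredWeight p k)
  rw [Finset.sum_eq_zero (s := signFinset d) (f := fun x => _ + _)] at h
  · simpa using h
  · intro x hx
    rw [centredWeight_add_flipSigns {k} (Finset.mem_singleton_self k) p (mem_signFinset.1 hx k)]
    simp

/-! ### The correlation as a function of `γ`. -/

/-- The correlation of the response with the `k`-th input in the logistic model with parameter `γ`,
as a finite sum over the cube. -/
noncomputable def cubeCorrelation {d : ℕ} (f : QuadPoly d) (p : Fin d → ℝ) (k : Fin d) (γ : ℝ) : ℝ :=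
  ∑ x ∈ signFinset d, centredWeight p k x * Real.sigmoid (γ * f.eval x)

theorem analyticOnNhd_cubeCorrelation {d : ℕ} (f : QuadPoly d) (p : Fin d → ℝ) (k : Fin d) :
    AnalyticOnNhd ℝ (cubeCorrelation f p k) Set.univ := by
  refine Finset.analyticOnNhd_fun_sum _ fun x _ => analyticOnNhd_const.mul ?_
  exact fun t _ => (analyticAt_id.mul analyticAt_const).sigmoid'

theorem cubeCorrelation_eq_zero {d : ℕ} (f : QuadPoly d) (p : Fin d → ℝ) {k : Fin d}
    (hk : k ∉ f.weakSupport) (γ : ℝ) : cubeCorrelation f p k γ = 0 := by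
  have hkQ : ∀ j, (k, j) ∉ f.Q ∧ (j, k) ∉ f.Q := fun j =>
    ⟨fun h => hk (Or.inr ⟨j, Or.inl h⟩), fun h => hk (Or.inr ⟨j, Or.inr h⟩)⟩
  have hev : ∀ x, f.eval (flipSigns {k} x) = f.eval x := by
    refine f.eval_flipSigns (fun i j h => ?_) fun j hj hjk => ?_
    · simp only [Finset.mem_singleton]
      constructor
      · rintro rfl; exact absurd h (hkQ j).1
      · rintro rfl; exact absurd h (hkQ i).2
    · rw [Finset.mem_singleton.1 hjk] at hj
      exact hk (Or.inl hj)
  have h := two_mul_sum_eq_sum_add_flipSigns {k} (signFinset d)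
    (fun x hx => mem_signFinset.2 (flipSigns_mem_signCube _ (mem_signFinset.1 hx)))
    fun x => centredWeight p k x * Real.sigmoid (γ * f.eval x)
  rw [Finset.sum_eq_zero (s := signFinset d) (f := fun x => _ + _)] at h
  · simpa [cubeCorrelation] using h
  · intro x hx
    rw [hev, ← add_mul, centredWeight_add_flipSigns {k} (Finset.mem_singleton_self k) p
      (mem_signFinset.1 hx k)]
    simp

theorem SimpleGraph.Reachable.eq_of_adj_eq {V α : Type*} {G : SimpleGraph V} {h : V → α}
    (hG : ∀ i j, G.Adj i j → h i = h j) {u v : V} (huv : G.Reachable u v) : h u = h v := by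
  obtain ⟨w⟩ := huv
  induction w with
  | nil => rfl
  | cons ha _ ih => exact (hG _ _ ha).trans ih

/-! ### Nonvanishing of the correlation under the two conditions. -/

namespace QuadPoly

variable {d : ℕ} {f : QuadPoly d}

/-- If the parities of `x` and `y` agree, then `x` and `y` agree up to a common sign on each
component of the graph of quadratic terms. -/
theorem mul_eq_mul_of_reachable {x y : Fin d → ℝ} (hx : x ∈ signCube d) (hy : y ∈ signCube d)
    (h : ∀ i j, (i, j) ∈ f.Q → x i * x j = y i * y j) {k j : Fin d} (hkj : f.graph.Reachable k j) :
    x k * y k = x j * y j := by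
  have key : ∀ i j, (i, j) ∈ f.Q → x i * y i = x j * y j := by
    intro i j hij
    have := h i j hij
    rcases hx i with h1 | h1 <;> rcases hx j with h2 | h2 <;> rcases hy i with h3 | h3 <;>
      rcases hy j with h4 | h4 <;> simp only [h1, h2, h3, h4] at this ⊢ <;> linarith
  refine hkj.eq_of_adj_eq (h := fun i => x i * y i) fun i j hij => ?_
  rcases hij with h | h
  · exact key i j h
  · exact (key j i h).symm

/-- The parities determine `f`, so a nonzero value `v` that fixes them excludes the value `-v`. -/
theorem eval_eq_of_fixesSigns {v : ℝ} (hv : v ∈ f.values) (h : f.FixesSigns v)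
    {x : Fin d → ℝ} (hx : x ∈ signCube d) (hxv : |f.eval x| = |v|) : f.eval x = v := by
  obtain ⟨y, hy, rfl⟩ := hv
  exact f.eval_congr (h x hx y hy hxv rfl).1 (h x hx y hy hxv rfl).2

/-- If the correlation vanishes for all `γ` and the value `v ≠ 0` fixes the signs, then the
contribution to the correlation of the points where `f` takes the value `v` vanishes. -/
theorem sum_centredWeight_eq_zero {p : Fin d → ℝ} {k : Fin d}
    (h : ∀ γ, cubeCorrelation f p k γ = 0) {v : ℝ} (hv0 : v ≠ 0) (hv : v ∈ f.values)
    (hfix : f.FixesSigns v) : ∑ x ∈ signFinset d with f.eval x = v, centredWeight p k x = 0 := by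
  have h1 := sum_mul_sign_eq_zero_of_sum_sigmoid (signFinset d) (centredWeight p k) f.eval h hv0
  have h2 : (signFinset d).filter (fun x => |f.eval x| = |v|)
      = (signFinset d).filter (fun x => f.eval x = v) :=
    Finset.filter_congr fun x hx =>
      ⟨eval_eq_of_fixesSigns hv hfix (mem_signFinset.1 hx), fun h => by rw [h]⟩
  rw [h2, Finset.sum_congr rfl (g := fun x => centredWeight p k x * Real.sign v)
    (fun x hx => by rw [(Finset.mem_filter.1 hx).2]), ← Finset.sum_mul] at h1
  exact (mul_eq_zero.1 h1).resolve_right (mt Real.sign_eq_zero_iff.1 hv0)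

/-- The correlation is not identically zero if the component of `k` contains a linear term and a
nonzero value fixes the signs of all parities. -/
theorem exists_cubeCorrelation_ne_zero_of_linear {p : Fin d → ℝ} (hp : ∀ i, 0 < p i ∧ p i < 1)
    {k : Fin d} (hk : ∃ j, f.graph.Reachable k j ∧ j ∈ f.L)
    (hv : ∃ v ∈ f.values, v ≠ 0 ∧ f.FixesSigns v) : ∃ γ, cubeCorrelation f p k γ ≠ 0 := by
  by_contra! hz
  obtain ⟨j, hkj, hj⟩ := hk
  obtain ⟨v, hv, hv0, hfix⟩ := hv
  have hsum := sum_centredWeight_eq_zero hz hv0 hv hfix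
  obtain ⟨z, hzc, hzv⟩ := id hv
  have hpos : 0 < ∑ x ∈ signFinset d with f.eval x = v, z k * centredWeight p k x := by
    refine Finset.sum_pos (fun x hx => ?_) ⟨z, Finset.mem_filter.2 ⟨mem_signFinset.2 hzc, hzv⟩⟩
    obtain ⟨hx, hxv⟩ := Finset.mem_filter.1 hx
    rw [mem_signFinset] at hx
    obtain ⟨hQ, hL⟩ := hfix x hx z hzc (by rw [hxv]) (by rw [hzv])
    have h1 := mul_eq_mul_of_reachable hx hzc hQ hkj
    rw [hL j hj] at h1
    have hw := signWeight_pos hp hx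
    -- By `h1`, `x k * z k = z j * z j = 1`, so `x k = z k`; the mean lies strictly between `-1` and
    -- `1`.
    have hc : 0 < z k * (x k - (2 * p k - 1)) := by
      have := hp k
      rcases hzc j with h2 | h2 <;> rcases hx k with h3 | h3 <;> rcases hzc k with h4 | h4 <;>
        rw [h2, h3, h4] at h1 <;> rw [h3, h4] <;> linarith
    calc 0 < signWeight p x * (z k * (x k - (2 * p k - 1))) := mul_pos hw hc
      _ = z k * centredWeight p k x := by rw [centredWeight]; ring
  rw [← Finset.mul_sum, hsum, mul_zero] at hpos
  exact lt_irrefl _ hpos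

/-- The correlation is not identically zero if the component of `k` contains no linear term, but an
edge, and all values fix the signs of all parities. -/
theorem exists_cubeCorrelation_ne_zero_of_no_linear {p : Fin d → ℝ}
    (hp : ∀ i, 0 < p i ∧ p i < 1) (hp2 : ∀ i, p i ≠ 1 / 2) {k : Fin d} (hk : k ∈ f.weakSupport)
    (hL : ∀ j, f.graph.Reachable k j → j ∉ f.L) (hv : ∀ v ∈ f.values, f.FixesSigns v) :
    ∃ γ, cubeCorrelation f p k γ ≠ 0 := by
  classical
  by_contra! hz
  have hsum : ∀ v ∈ f.values,
      ∑ x ∈ signFinset d with f.eval x = v, centredWeight p k x = 0 := by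
    intro v hvv
    rcases eq_or_ne v 0 with rfl | hv0
    -- The sigmoid argument says nothing about level `0`, but the total over the cube is zero and
    -- every other level contributes zero.
    · have h1 := sum_centredWeight p k
      rw [← Finset.sum_fiberwise_of_maps_to
        (fun x hx => Finset.mem_image_of_mem f.eval hx), Finset.sum_eq_single 0] at h1
      · exact h1
      · intro b hb hb0
        obtain ⟨x, hx, rfl⟩ := Finset.mem_image.1 hb
        have hxv : f.eval x ∈ f.values := ⟨x, mem_signFinset.1 hx, rfl⟩
        exact sum_centredWeight_eq_zero hz hb0 hxv (hv _ hxv)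
      · intro h0
        obtain ⟨x, hx, hx0⟩ := hvv
        exact absurd (Finset.mem_image.2 ⟨x, mem_signFinset.2 hx, hx0⟩) h0
    · exact sum_centredWeight_eq_zero hz hv0 hvv (hv v hvv)
  obtain ⟨j, hkj⟩ : ∃ j, f.graph.Adj k j :=
    hk.resolve_left (hL k (SimpleGraph.Reachable.refl k))
  set A : Finset (Fin d) := Finset.univ.filter fun i => f.graph.Reachable k i with hA
  have memA : ∀ i, i ∈ A ↔ f.graph.Reachable k i := by simp [hA]
  have hkA : k ∈ A := (memA k).2 (SimpleGraph.Reachable.refl k)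
  have hne : (A.erase k).Nonempty :=
    ⟨j, Finset.mem_erase.2 ⟨hkj.ne', (memA j).2 hkj.reachable⟩⟩
  have hev : ∀ x, f.eval (flipSigns A x) = f.eval x := by
    refine f.eval_flipSigns (fun i j h => ?_) fun j hj hjA => hL j ((memA j).1 hjA) hj
    have hij : f.graph.Adj i j := Or.inl h
    rw [memA, memA]
    exact ⟨fun h => h.trans hij.reachable, fun h => h.trans hij.symm.reachable⟩
  set z : Fin d → ℝ := fun i => if i = k then 1 else likelySign (p i) with hzdef
  have hzk : z k = 1 := if_pos rfl
  have hzi : ∀ i, i ≠ k → z i = likelySign (p i) := fun i hi => if_neg hi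
  have hzc : z ∈ signCube d := by
    intro i
    rcases eq_or_ne i k with rfl | hi
    · exact Or.inl hzk
    · rw [hzi i hi]
      unfold likelySign
      split_ifs <;> simp
  have hlt : ∏ i ∈ A.erase k, signProb (p i) (-z i) < ∏ i ∈ A.erase k, signProb (p i) (z i) := by
    refine Finset.prod_lt_prod_of_nonempty (fun i _ => signProb_pos (hp i).1 (hp i).2 ?_)
      (fun i hi => ?_) hne
    · rcases hzc i with h | h <;> simp [h]
    · rw [hzi i (Finset.ne_of_mem_erase hi)]
      exact signProb_neg_likelySign_lt (hp2 i)
  have h0 := hsum (f.eval z) ⟨z, hzc, rfl⟩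
  have h2 := two_mul_sum_eq_sum_add_flipSigns A
    ((signFinset d).filter fun x => f.eval x = f.eval z)
    (fun x hx => by
      obtain ⟨hx, hxz⟩ := Finset.mem_filter.1 hx
      exact Finset.mem_filter.2
        ⟨mem_signFinset.2 (flipSigns_mem_signCube _ (mem_signFinset.1 hx)), (hev x).trans hxz⟩)
    (centredWeight p k)
  rw [h0, mul_zero] at h2
  refine h2.not_lt (Finset.sum_pos (fun x hx => ?_)
    ⟨z, Finset.mem_filter.2 ⟨mem_signFinset.2 hzc, rfl⟩⟩)
  obtain ⟨hx, hxz⟩ := Finset.mem_filter.1 hx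
  rw [mem_signFinset] at hx
  obtain ⟨hQ, -⟩ := hv (f.eval z) ⟨z, hzc, rfl⟩ x hx z hzc (by rw [hxz]) rfl
  have hxA : ∀ i ∈ A, x i = x k * z i := by
    intro i hi
    have h1 := mul_eq_mul_of_reachable hx hzc hQ ((memA i).1 hi)
    rw [hzk, mul_one] at h1
    rw [h1]
    rcases hzc i with h | h <;> rw [h] <;> ring
  rw [centredWeight_add_flipSigns A hkA p (hx k)]
  have hk1 := (hp k).1
  have hk2 := sub_pos.2 (hp k).2
  refine mul_pos (mul_pos (Finset.prod_pos fun i _ =>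
    signProb_pos (hp i).1 (hp i).2 (hx i)) (by positivity)) ?_
  have e1 : ∏ i ∈ A.erase k, signProb (p i) (x i)
      = ∏ i ∈ A.erase k, signProb (p i) (x k * z i) :=
    Finset.prod_congr rfl fun i hi => by rw [← hxA i (Finset.mem_of_mem_erase hi)]
  have e2 : ∏ i ∈ A.erase k, signProb (p i) (-x i)
      = ∏ i ∈ A.erase k, signProb (p i) (-(x k * z i)) :=
    Finset.prod_congr rfl fun i hi => by rw [← hxA i (Finset.mem_of_mem_erase hi)]
  rw [e1, e2]
  -- On `A`, `x` is `z` or `-z`; the outer factor `x k` turns both cases into `hlt`.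
  rcases hx k with h | h <;> simp only [h, one_mul, neg_mul, neg_neg] <;> linarith

end QuadPoly

/-! ### From the probabilistic model to sums over the cube. -/

namespace IsLogisticModel

variable {d : ℕ} {Ω : Type*} [MeasurableSpace Ω] {μ : Measure Ω} {f : QuadPoly d} {p : Fin d → ℝ}
  {γ : ℝ} {X : Fin d → Ω → ℝ} {Y : Ω → ℝ}

theorem measurableSet_X_eq (h : IsLogisticModel μ f p γ X Y) (i : Fin d) (s : ℝ) :
    MeasurableSet {ω | X i ω = s} :=
  h.measurable_X i (measurableSet_singleton s)

theorem measurableSet_forall_X_eq (h : IsLogisticModel μ f p γ X Y) (x : Fin d → ℝ) :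
    MeasurableSet {ω | ∀ i, X i ω = x i} := by
  rw [Set.ofPred_forall]
  exact MeasurableSet.iInter fun i => h.measurableSet_X_eq i (x i)

theorem measurableSet_Y_eq (h : IsLogisticModel μ f p γ X Y) (s : ℝ) :
    MeasurableSet {ω | Y ω = s} :=
  h.measurable_Y (measurableSet_singleton s)

theorem measureReal_X_eq (h : IsLogisticModel μ f p γ X Y) (i : Fin d) {s : ℝ}
    (hs : s = 1 ∨ s = -1) : μ.real {ω | X i ω = s} = signProb (p i) s := by
  have := h.isProbabilityMeasure
  rcases hs with rfl | rfl
  · rw [h.bias i, signProb_one]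
  · have : μ.real {ω | X i ω = -1} = μ.real ({ω | X i ω = 1}ᶜ) := by
      refine measureReal_congr ?_
      filter_upwards [h.X_mem i] with ω hω
      refine propext ⟨fun (h1 : X i ω = -1) (h2 : X i ω = 1) => by linarith, fun h1 => ?_⟩
      exact hω.resolve_left h1
    rw [this, probReal_compl_eq_one_sub (h.measurableSet_X_eq i 1), h.bias i,
      signProb_neg_one]

theorem measureReal_forall_X_eq (h : IsLogisticModel μ f p γ X Y) {x : Fin d → ℝ}
    (hx : x ∈ signCube d) : μ.real {ω | ∀ i, X i ω = x i} = signWeight p x := by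
  have h1 := h.indep.measure_inter_preimage_eq_mul Finset.univ (sets := fun i => {x i})
    fun i _ => measurableSet_singleton _
  have h2 : {ω | ∀ i, X i ω = x i} = ⋂ i ∈ Finset.univ, X i ⁻¹' {x i} := by
    ext ω; simp
  rw [measureReal_def, h2, h1, ENNReal.toReal_prod]
  exact Finset.prod_congr rfl fun i _ => h.measureReal_X_eq i (hx i)

/-- Positive weights make the conditioning events non-null, so `cond_prob` can be multiplied out. -/
theorem measureReal_inter (h : IsLogisticModel μ f p γ X Y) (hp : ∀ i, 0 < p i ∧ p i < 1)
    {x : Fin d → ℝ} (hx : x ∈ signCube d) :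
    μ.real ({ω | ∀ i, X i ω = x i} ∩ {ω | Y ω = 1})
      = signWeight p x * Real.sigmoid (γ * f.eval x) := by
  have h1 := h.cond_prob x hx
  have h2 : Real.exp (γ * f.eval x) / (1 + Real.exp (γ * f.eval x))
      = Real.sigmoid (γ * f.eval x) := by
    rw [Real.sigmoid_def, Real.exp_neg]
    have := Real.exp_pos (γ * f.eval x)
    field_simp
    ring
  rw [h2, measureReal_def, cond_apply (h.measurableSet_forall_X_eq x), ENNReal.toReal_mul,
    ENNReal.toReal_inv, ← measureReal_def, ← measureReal_def, h.measureReal_forall_X_eq hx] at h1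
  rw [← h1, ← mul_assoc, mul_inv_cancel₀ (signWeight_pos hp hx).ne', one_mul]

theorem integral_X (h : IsLogisticModel μ f p γ X Y) (k : Fin d) :
    ∫ ω, X k ω ∂μ = 2 * p k - 1 := by
  have := h.isProbabilityMeasure
  have h1 : X k =ᵐ[μ] fun ω => {ω | X k ω = 1}.indicator (fun _ => (2 : ℝ)) ω - 1 := by
    filter_upwards [h.X_mem k] with ω hω
    rcases hω with hω | hω
    · rw [Set.indicator_of_mem (by exact hω), hω]; norm_num
    · rw [Set.indicator_of_notMem (by
        simp only [Set.mem_ofPred_eq, hω]; norm_num), hω]; norm_num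
  rw [integral_congr_ae h1, integral_sub
    ((integrable_const _).indicator (h.measurableSet_X_eq k 1)) (integrable_const _),
    integral_indicator_const _ (h.measurableSet_X_eq k 1), h.bias k]
  simp [mul_comm]

theorem integral_mul_eq_sum (h : IsLogisticModel μ f p γ X Y) (hp : ∀ i, 0 < p i ∧ p i < 1)
    (g : (Fin d → ℝ) → ℝ) :
    ∫ ω, Y ω * g (fun i => X i ω) ∂μ
      = ∑ x ∈ signFinset d, signWeight p x * g x * Real.sigmoid (γ * f.eval x) := by
  have := h.isProbabilityMeasure
  have hms : ∀ x : Fin d → ℝ, MeasurableSet ({ω | ∀ i, X i ω = x i} ∩ {ω | Y ω = 1}) :=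
    fun x => (h.measurableSet_forall_X_eq x).inter (h.measurableSet_Y_eq 1)
  have h1 : (fun ω => Y ω * g (fun i => X i ω)) =ᵐ[μ] fun ω => ∑ x ∈ signFinset d,
      ({ω | ∀ i, X i ω = x i} ∩ {ω | Y ω = 1}).indicator (fun _ => g x) ω := by
    filter_upwards [ae_all_iff.2 h.X_mem, h.Y_mem] with ω hX hY
    rw [Finset.sum_eq_single_of_mem (fun i => X i ω) (mem_signFinset.2 hX)]
    · rcases hY with hY | hY <;> simp [hY]
    · intro x _ hx
      exact Set.indicator_of_notMem (fun hm => hx (funext fun i => (hm.1 i).symm)) _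
  rw [integral_congr_ae h1, integral_finsetSum _
    fun x _ => (integrable_const (g x)).indicator (hms x)]
  refine Finset.sum_congr rfl fun x hx => ?_
  rw [integral_indicator_const _ (hms x), h.measureReal_inter hp (mem_signFinset.1 hx), smul_eq_mul]
  ring

theorem correlation_eq (h : IsLogisticModel μ f p γ X Y) (hp : ∀ i, 0 < p i ∧ p i < 1)
    (k : Fin d) : correlation μ Y (X k) = cubeCorrelation f p k γ := by
  rw [correlation, h.integral_X k]
  exact h.integral_mul_eq_sum hp fun x => x k - (2 * p k - 1)

theorem correlation_eq_zero_of_indepFun (h : IsLogisticModel μ f p γ X Y) {k : Fin d}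
    (hi : IndepFun Y (X k) μ) : correlation μ Y (X k) = 0 := by
  have := h.isProbabilityMeasure
  have hint : Integrable (X k) μ := by
    refine Integrable.of_bound (h.measurable_X k).aestronglyMeasurable 1 ?_
    filter_upwards [h.X_mem k] with ω hω
    rcases hω with hω | hω <;> simp [hω]
  have h1 := (hi.comp measurable_id
    (measurable_id.sub_const (∫ ω', X k ω' ∂μ))).integral_fun_mul_eq_mul_integral
    h.measurable_Y.aestronglyMeasurable
    ((h.measurable_X k).sub_const _).aestronglyMeasurable
  simp only [Function.comp_apply, id_eq] at h1
  rw [correlation, h1, integral_sub hint (integrable_const _)]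
  simp

/-- For two-valued variables uncorrelated means independent: the correlation is `2 * (μ.real (A ∩ B)
- μ.real A * μ.real B)`, and `Y` and `X k` are a.e. functions of the indicators of `A` and `B`. -/
theorem indepFun_of_correlation_eq_zero (h : IsLogisticModel μ f p γ X Y) {k : Fin d}
    (h0 : correlation μ Y (X k) = 0) : IndepFun Y (X k) μ := by
  have := h.isProbabilityMeasure
  set A := {ω | Y ω = 1} with hA
  set B := {ω | X k ω = 1} with hB
  have hAm : MeasurableSet A := h.measurableSet_Y_eq 1
  have hBm : MeasurableSet B := h.measurableSet_X_eq k 1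
  have hY : A.indicator (fun _ => (1 : ℝ)) =ᵐ[μ] Y := by
    filter_upwards [h.Y_mem] with ω hω
    rcases hω with hω | hω <;> simp [hA, hω]
  have hX : (fun ω => 2 * B.indicator (fun _ => (1 : ℝ)) ω - 1) =ᵐ[μ] X k := by
    filter_upwards [h.X_mem k] with ω hω
    rcases hω with hω | hω <;> norm_num [hB, Set.indicator_apply, hω]
  have hAB : μ.real (A ∩ B) = μ.real A * μ.real B := by
    have e : (fun ω => Y ω * (X k ω - (2 * p k - 1))) =ᵐ[μ] fun ω =>
        (A ∩ B).indicator (fun _ => (2 : ℝ)) ω - A.indicator (fun _ => 2 * p k) ω := by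
      filter_upwards [hY, hX] with ω h1 h2
      rw [← h1, ← h2]
      by_cases ha : ω ∈ A <;> by_cases hb : ω ∈ B <;> simp [ha, hb]
      ring
    rw [correlation, h.integral_X k, integral_congr_ae e, integral_sub
      ((integrable_const _).indicator (hAm.inter hBm)) ((integrable_const _).indicator hAm),
      integral_indicator_const _ (hAm.inter hBm), integral_indicator_const _ hAm] at h0
    simp only [smul_eq_mul] at h0
    rw [hB, h.bias k]
    linarith
  have hind : IndepSet A B μ := by
    rw [indepSet_iff_measure_inter_eq_mul hAm hBm μ,
      ← ENNReal.toReal_eq_toReal_iff' (by finiteness) (by finiteness), ENNReal.toReal_mul]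
    exact hAB
  have hfun : IndepFun (A.indicator fun _ => (1 : ℝ)) (B.indicator fun _ => (1 : ℝ)) μ := by
    have mA : MeasurableSet[MeasurableSpace.generateFrom {A}] A :=
      MeasurableSpace.measurableSet_generateFrom (Set.mem_singleton A)
    have mB : MeasurableSet[MeasurableSpace.generateFrom {B}] B :=
      MeasurableSpace.measurableSet_generateFrom (Set.mem_singleton B)
    exact indep_of_indep_of_le_left (indep_of_indep_of_le_right hind
      (measurable_const.indicator mB).comap_le) (measurable_const.indicator mA).comap_le
  exact (hfun.comp measurable_id ((measurable_id.const_mul 2).sub_const 1)).congr hY hX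

end IsLogisticModel

/-! ### Assembly of the theorem. -/

theorem theorem1 {d : ℕ} (f : QuadPoly d) (p : Fin d → ℝ) (δ : ℝ) (hδ : 0 < δ)
    (hp : ∀ i, p i ∈ Set.Ioo δ (1 / 2 - δ) ∪ Set.Ioo (1 / 2 + δ) (1 - δ)) (k : Fin d) :
    -- the correlation vanishes whenever `Y` is independent of `X k`
    (∀ (γ : ℝ) (Ω : Type*) [MeasurableSpace Ω] (μ : Measure Ω) (X : Fin d → Ω → ℝ) (Y : Ω → ℝ),
      IsLogisticModel μ f p γ X Y → IndepFun Y (X k) μ → correlation μ Y (X k) = 0) ∧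
    -- `Y` is independent of `X k` if `f` does not depend on the `k`-th variable
    (k ∉ f.weakSupport →
      ∀ (γ : ℝ) (Ω : Type*) [MeasurableSpace Ω] (μ : Measure Ω) (X : Fin d → Ω → ℝ) (Y : Ω → ℝ),
        IsLogisticModel μ f p γ X Y → IndepFun Y (X k) μ) ∧
    -- the correlation is nonzero for all but finitely many `γ ∈ [0, 1]` if `f` depends on it
    (k ∈ f.weakSupport →
      (((∃ j, f.graph.Reachable k j ∧ j ∈ f.L) ∧ ∃ v ∈ f.values, v ≠ 0 ∧ f.FixesSigns v) ∨
        ((∀ j, f.graph.Reachable k j → j ∉ f.L) ∧ ∀ v ∈ f.values, f.FixesSigns v)) →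
      ∃ S : Set ℝ, S.Finite ∧ ∀ γ ∈ Set.Icc (0 : ℝ) 1, γ ∉ S →
        ∀ (Ω : Type*) [MeasurableSpace Ω] (μ : Measure Ω) (X : Fin d → Ω → ℝ) (Y : Ω → ℝ),
          IsLogisticModel μ f p γ X Y → correlation μ Y (X k) ≠ 0) := by

  have hp1 : ∀ i, 0 < p i ∧ p i < 1 := by
    intro i
    rcases hp i with h | h <;> constructor <;> linarith [h.1, h.2]
  have hp2 : ∀ i, p i ≠ 1 / 2 := by
    intro i
    rcases hp i with h | h
    · exact ne_of_lt (by linarith [h.2])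
    · exact ne_of_gt (by linarith [h.1])
  refine ⟨fun γ Ω _ μ X Y h hi => h.correlation_eq_zero_of_indepFun hi,
    fun hk γ Ω _ μ X Y h => h.indepFun_of_correlation_eq_zero ?_, fun hk hc => ?_⟩
  · rw [h.correlation_eq hp1, cubeCorrelation_eq_zero f p hk]
  · obtain ⟨γ₀, hγ₀⟩ : ∃ γ, cubeCorrelation f p k γ ≠ 0 := by
      rcases hc with ⟨hL, hv⟩ | ⟨hL, hv⟩
      · exact QuadPoly.exists_cubeCorrelation_ne_zero_of_linear hp1 hL hv
      · exact QuadPoly.exists_cubeCorrelation_ne_zero_of_no_linear hp1 hp2 hk hL hv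
    -- The exceptional set depends only on `f`, `p` and `k`, so it serves all models at once.
    refine ⟨{γ ∈ Set.Icc (0 : ℝ) 1 | cubeCorrelation f p k γ = 0}, ?_, ?_⟩
    · by_contra hinf
      exact hγ₀ ((analyticOnNhd_cubeCorrelation f p k).eq_zero_of_infinite_zeros
        isCompact_Icc hinf γ₀)
    · intro γ hγ hS Ω _ μ X Y h h0
      exact hS ⟨hγ, by rwa [← h.correlation_eq hp1]⟩
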